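/- Let $\mathcal X,\mathcal Y,\mathcal U$ be Polish spaces (state, measurement and action space) with their Borel $\sigma$-algebras, $\mathcal X$ being $\sigma$-compact; let $T(dx'\mid x,u)$ be a stochastic kernel from $\mathcal X\times\mathcal U$ to $\mathcal X$ and $Q(dy\mid x)$ a stochastic kernel from $\mathcal X$ to $\mathcal Y$. An admissible policy is a sequence $\gamma=(\gamma_n)_{n\ge 0}$ of measurable maps $\gamma_n:\mathcal Y^{n+1}\times\mathcal U^{n}\to\mathcal U$; it generates the actions $u_n=\gamma_n(y_0,\dots,y_n,u_0,\dots,u_{n-1})$. For a probability measure $\mu$ on $\mathcal X$ and an admissible policy $\gamma$, let $P^{\mu,\gamma}$ be the probability measure on sequences $(x_n,y_n)_{n\ge 0}$ in $\mathcal X\times\mathcal Y$ under which $(X_0,Y_0)\sim Q(dy\mid x)\,\mu(dx)$ and, for $n\ge 1$, the conditional law of $(X_n,Y_n)$ given $(X_i,Y_i)_{i\le n-1}=(x_i,y_i)_{i\le n-1}$ is $Q(dy\mid x)\,T(dx\mid x_{n-1},u_{n-1})$. The predictor $\pi^{\mu,\gamma}_{n-}$ is the regular conditional distribution of $X_n$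 given $(Y_0,\dots,Y_{n-1})$ under $P^{\mu,\gamma}$, viewed as a function of the measurements. Let $\mu,\nu$ be probability measures on $\mathcal X$ with $\mu\ll\nu$, and suppose that the model is one-step observable: for every bounded continuous $f:\mathcal X\to\mathbb R$ and every $\varepsilon>0$ there is a bounded measurable $g:\mathcal Y\to\mathbb R$ with $$\sup_{x\in\mathcal X}\Big|f(x)-\int_{\mathcal Y} g(y)\,Q(dy\mid x)\Big|<\varepsilon .$$ Then for every admissible policy $\gamma$ the predictors started from $\mu$ and from $\nu$ merge weakly $P^{\mu,\gamma}$-almost surely: there is a measurable set $A\subset\mathcal Y^{\mathbb Z_+}$ of measurement sequences with $P^{\mu,\gamma}\big((Y_n)_{n\ge0}\in A\big)=1$ such that, along every sequence in $A$, for every bounded continuous $f:\mathcal X\to\mathbb R$, $$\lim_{n\to\infty}\Big|\int f\,d\pi^{\mu,\gamma}_{n-}-\int f\,d\pi^{\nu,\gamma}_{n-}\Big|=0 .$$ -/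

import Mathlib

open MeasureTheory ProbabilityTheory Filter Topology
open scoped BoundedContinuousFunction

namespace ControlledFilter

/-- An admissible (deterministic) control policy: a sequence of measurable maps
`γₙ : 𝒴ⁿ⁺¹ × 𝒰ⁿ → 𝒰` producing the action
`uₙ = γₙ(y₀, …, yₙ, u₀, …, uₙ₋₁)`. -/
structure Policy (Y U : Type*) [MeasurableSpace Y] [MeasurableSpace U] where
  /-- the decision rule at time `n` -/
  rule : (n : ℕ) → (Fin (n + 1) → Y) × (Fin n → U) → U
  measurable_rule : ∀ n, Measurable (rule n)

namespace Policy

variable {Y U : Type*} [MeasurableSpace Y] [MeasurableSpace U]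

/-- The actions `(u₀, …, uₙ₋₁)` produced by the policy from the measurements
`(y₀, …, yₙ₋₁)`. -/
def pastActions (γ : Policy Y U) : (n : ℕ) → (Fin n → Y) → (Fin n → U)
  | 0, _ => Fin.elim0
  | n + 1, y =>
      Fin.snoc (α := fun _ => U) (γ.pastActions n (Fin.init y))
        (γ.rule n (y, γ.pastActions n (Fin.init y)))

/-- The action `uₙ = γₙ(y₀, …, yₙ, u₀, …, uₙ₋₁)`, as a function of the measurements. -/
def action (γ : Policy Y U) (n : ℕ) (y : Fin (n + 1) → Y) : U :=
  γ.rule n (y, γ.pastActions n (Fin.init y))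

lemma measurable_init (n : ℕ) :
    Measurable (fun y : Fin (n + 1) → Y => (Fin.init y : Fin n → Y)) :=
  measurable_pi_lambda _ fun i => measurable_pi_apply i.castSucc

lemma measurable_pastActions (γ : Policy Y U) (n : ℕ) : Measurable (γ.pastActions n) := by
  induction n with
  | zero => exact measurable_pi_lambda _ fun i => i.elim0
  | succ n ih =>
    have h := ih.comp (measurable_init (Y := Y) n)
    refine measurable_pi_lambda _ fun i => ?_
    refine Fin.lastCases ?_ (fun j => ?_) i
    · simpa [pastActions, Function.comp_def] using
        (γ.measurable_rule n).comp (measurable_id.prodMk h)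
    · simpa [pastActions, Function.comp_def] using (measurable_pi_apply j).comp h

lemma measurable_action (γ : Policy Y U) (n : ℕ) : Measurable (γ.action n) :=
  (γ.measurable_rule n).comp
    (measurable_id.prodMk ((γ.measurable_pastActions n).comp (measurable_init n)))

end Policy

section Model

variable {X Y U : Type*} [MeasurableSpace X] [MeasurableSpace Y] [MeasurableSpace U]

/-- From a history `((x₀, y₀), …, (xₙ, yₙ))`, the pair `(xₙ, uₙ)` of the current state and the
action chosen by the policy. -/
def stateAction (γ : Policy Y U) (n : ℕ) (h : (i : Finset.Iic n) → X × Y) : X × U :=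
  ((h ⟨n, Finset.mem_Iic.2 le_rfl⟩).1,
    γ.action n fun i => (h ⟨i, Finset.mem_Iic.2 (Nat.le_of_lt_succ i.2)⟩).2)

lemma measurable_stateAction (γ : Policy Y U) (n : ℕ) :
    Measurable (stateAction (X := X) γ n) :=
  (measurable_fst.comp (measurable_pi_apply _)).prodMk
    ((γ.measurable_action n).comp
      (measurable_pi_lambda _ fun _ => measurable_snd.comp (measurable_pi_apply _)))

/-- The conditional law of `(Xₙ₊₁, Yₙ₊₁)` given the history up to time `n`:
`Q(dy | x) T(dx | xₙ, uₙ)`. -/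
noncomputable def stepKernel (T : Kernel (X × U) X) (Q : Kernel X Y) (γ : Policy Y U) (n : ℕ) :
    Kernel ((i : Finset.Iic n) → X × Y) (X × Y) :=
  (T.comap (stateAction γ n) (measurable_stateAction γ n)).compProd (Kernel.prodMkLeft _ Q)

instance (T : Kernel (X × U) X) [IsMarkovKernel T] (Q : Kernel X Y) [IsMarkovKernel Q]
    (γ : Policy Y U) (n : ℕ) : IsMarkovKernel (stepKernel T Q γ n) := by
  unfold stepKernel; infer_instance

/-- The strategic measure `P^{μ,γ}` on sequences `((xₙ, yₙ))ₙ`: the law with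
`(X₀, Y₀) ∼ Q(dy | x) μ(dx)` and one-step conditional laws `stepKernel`
(Ionescu-Tulcea construction). -/
noncomputable def strategicMeasure (T : Kernel (X × U) X) [IsMarkovKernel T]
    (Q : Kernel X Y) [IsMarkovKernel Q] (γ : Policy Y U) (μ : Measure X) :
    Measure (ℕ → X × Y) :=
  Kernel.trajMeasure (X := fun _ => X × Y) (μ.compProd Q) (fun n => stepKernel T Q γ n)

instance (T : Kernel (X × U) X) [IsMarkovKernel T] (Q : Kernel X Y) [IsMarkovKernel Q]
    (γ : Policy Y U) (μ : Measure X) [IsProbabilityMeasure μ] :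
    IsProbabilityMeasure (strategicMeasure T Q γ μ) := by
  unfold strategicMeasure; infer_instance

/-- The first `n` terms `(y₀, …, yₙ₋₁)` of a measurement sequence. -/
def past (n : ℕ) (y : ℕ → Y) : Fin n → Y := fun i => y i

/-- The predictor `π_{n-}^{μ,γ}`: the regular conditional distribution of `Xₙ` given
`(Y₀, …, Yₙ₋₁)` under `P^{μ,γ}`, as a kernel from measurement histories to states. -/
noncomputable def predictor [StandardBorelSpace X] [Nonempty X]
    (T : Kernel (X × U) X) [IsMarkovKernel T] (Q : Kernel X Y) [IsMarkovKernel Q]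
    (γ : Policy Y U) (μ : Measure X) [IsProbabilityMeasure μ] (n : ℕ) :
    Kernel (Fin n → Y) X :=
  condDistrib (fun ω : ℕ → X × Y => (ω n).1) (fun ω : ℕ → X × Y => past n fun i => (ω i).2)
    (strategicMeasure T Q γ μ)

/-- Every bounded continuous `f` on the state space is, for every `ε > 0`, uniformly
`ε`-close to `x ↦ ∫ g(y) Q(dy | x)` for some bounded measurable `g`. -/
def OneStepObservable [TopologicalSpace X] (Q : Kernel X Y) : Prop :=
  ∀ f : X →ᵇ ℝ, ∀ ε : ℝ, 0 < ε →
    ∃ g : Y → ℝ, Measurable g ∧ (∃ C : ℝ, ∀ y, |g y| ≤ C) ∧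
      ∀ x, |f x - ∫ y, g y ∂(Q x)| < ε

/-- Weak merging of two sequences of measures. -/
def MergeWeakly [TopologicalSpace X] (P P' : ℕ → Measure X) : Prop :=
  ∀ f : X →ᵇ ℝ, Tendsto (fun n => |∫ x, f x ∂(P n) - ∫ x, f x ∂(P' n)|) atTop (𝓝 0)

/-- The predictors started from `μ` and from `ν` under the policy `γ` merge weakly,
`P^{μ,γ}`-almost surely: there is a set of measurement sequences of `P^{μ,γ}`-probability one
on which they merge weakly (simultaneously for all test functions). -/
def PredictorsMergeWeaklyAS [TopologicalSpace X] [StandardBorelSpace X] [Nonempty X]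
    (T : Kernel (X × U) X) [IsMarkovKernel T] (Q : Kernel X Y) [IsMarkovKernel Q]
    (γ : Policy Y U) (μ ν : Measure X) [IsProbabilityMeasure μ] [IsProbabilityMeasure ν] : Prop :=
  ∃ A : Set (ℕ → Y), MeasurableSet A ∧
    strategicMeasure T Q γ μ {ω | (fun n => (ω n).2) ∈ A} = 1 ∧
    ∀ y ∈ A, MergeWeakly (fun n => predictor T Q γ μ n (past n y))
      (fun n => predictor T Q γ ν n (past n y))

end Model

end ControlledFilter

/-!
Since `μ ≪ ν`, the law `p` of the measurement sequence started from `μ` is absolutely continuous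
with respect to the law `q` started from `ν`: the controls are functions of the measurements, so
both trajectories are driven by the same kernels
(`ControlledFilter.strategicMeasure_absolutelyContinuous`). Let `R = dp/dq`, let `ℱₙ` be generated
by `y₀, …, yₙ₋₁`, and let `Rₙ = E_q[R | ℱₙ]`.

By Bayes' rule (`condExp_mul_condExp_rnDeriv`), for every `f` bounded by `1`,
`|E_p[f | ℱₙ] - E_q[f | ℱₙ]| ≤ E_q[|R - Rₙ| | ℱₙ] / Rₙ`.
The right-hand side does not involve `f`, and it tends to zero `p`-almost surely by Lévy's upward
theorem (`exists_tendsto_zero_abs_condExp_sub_condExp_le`); this is Blackwell–Dubins merging.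

The conditional law of `yₙ` given `ℱₙ` is the predictor followed by the sensor kernel `Q`
(`ControlledFilter.map_past_compProd_predictor`). Applying the bound to the events `yₙ ∈ A`, with
`A` in a countable algebra generating the measurable sets, shows that these conditional laws merge
in total variation outside a single null set
(`ControlledFilter.ae_exists_tendsto_zero_abs_measurement_law_sub_le`). By one-step observability
every bounded continuous function of the state is uniformly close to some `x ↦ ∫ g dQ(x)` with `g`
bounded, so the predictors merge against all bounded continuous functions outside that same null set
(`ControlledFilter.mergeWeakly_of_oneStepObservable`). No separability of the space of test
functions is needed.
-/

/-! ### Merging of conditional expectations under absolute continuity -/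

section Merging

variable {Ω : Type*} {m m0 : MeasurableSpace Ω} {p q : Measure Ω}

/-- Bayes' rule for a change of measure: with `R = dp/dq`, one has
`E_p[f | m] E_q[R | m] = E_q[R f | m]`. -/
lemma condExp_mul_condExp_rnDeriv [IsProbabilityMeasure p] [IsProbabilityMeasure q]
    (hpq : p ≪ q) (hm : m ≤ m0) {f : Ω → ℝ} (hf : Integrable f p) :
    (fun ω => p[f|m] ω * q[fun ω => (p.rnDeriv q ω).toReal|m] ω)
      =ᵐ[q] q[fun ω => (p.rnDeriv q ω).toReal * f ω|m] := by
  have hR : Integrable (fun ω => (p.rnDeriv q ω).toReal) q := Measure.integrable_toReal_rnDeriv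
  have hfR : Integrable (fun ω => (p.rnDeriv q ω).toReal * f ω) q :=
    (integrable_rnDeriv_smul_iff hpq).2 hf
  have hcR : Integrable (fun ω => p[f|m] ω * (p.rnDeriv q ω).toReal) q := by
    simpa only [smul_eq_mul, mul_comm] using
      (integrable_rnDeriv_smul_iff (f := p[f|m]) hpq).2 integrable_condExp
  have hpull : q[fun ω => p[f|m] ω * (p.rnDeriv q ω).toReal|m] =ᵐ[q]
      fun ω => p[f|m] ω * q[fun ω => (p.rnDeriv q ω).toReal|m] ω :=
    condExp_mul_of_stronglyMeasurable_left stronglyMeasurable_condExp hcR hR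
  refine hpull.symm.trans ?_
  refine ae_eq_condExp_of_forall_setIntegral_eq hm hfR
    (fun s _ _ => integrable_condExp.integrableOn) (fun s hs _ => ?_)
    stronglyMeasurable_condExp.aestronglyMeasurable
  rw [setIntegral_condExp hm hcR hs, setIntegral_toReal_rnDeriv_mul hpq (hm s hs),
    ← setIntegral_condExp hm hf hs, ← setIntegral_toReal_rnDeriv_mul hpq (hm s hs)]
  simp only [mul_comm]

lemma ae_toReal_rnDeriv_pos [SigmaFinite p] [SigmaFinite q] (hpq : p ≪ q) :
    ∀ᵐ ω ∂p, 0 < (p.rnDeriv q ω).toReal := by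
  filter_upwards [Measure.rnDeriv_pos hpq, hpq.ae_le (Measure.rnDeriv_ne_top p q)] with ω h1 h2
  exact ENNReal.toReal_pos h1.ne' h2

/-- The conditional mean deviation of `R` from its martingale `Rₙ = E[R | ℱₙ]` tends to zero almost
surely. The martingale need not be dominated: for `k ≤ n` the deviation is at most
`E[|R - R_k| | ℱₙ] + |R_k - Rₙ|`, which tends to `2 |R - R_k|` by Lévy's theorem, and this is
small for large `k`. -/
lemma tendsto_condExp_abs_sub_condExp [IsFiniteMeasure q] (ℱ : Filtration ℕ m0)
    (hℱ : ⨆ n, ℱ n = m0) {R : Ω → ℝ} (hR : Integrable R q) (hRm : Measurable R) :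
    ∀ᵐ ω ∂q, Tendsto (fun n => q[fun ω => |R ω - q[R|ℱ n] ω| | ℱ n] ω) atTop (𝓝 0) := by
  have hlim : ∀ g : Ω → ℝ, Integrable g q → Measurable g →
      ∀ᵐ ω ∂q, Tendsto (fun n => q[g|ℱ n] ω) atTop (𝓝 (g ω)) := fun g hg hgm =>
    hg.tendsto_ae_condExp (by rw [hℱ]; exact hgm.stronglyMeasurable)
  have hRl := hlim R hR hRm
  have hint : ∀ k, Integrable (fun ω => |R ω - q[R|ℱ k] ω|) q := fun k =>
    (hR.sub integrable_condExp).abs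
  have hRk : ∀ k, ∀ᵐ ω ∂q, Tendsto (fun n => q[fun ω => |R ω - q[R|ℱ k] ω| | ℱ n] ω) atTop
      (𝓝 |R ω - q[R|ℱ k] ω|) := fun k => hlim _ (hint k)
    ((hRm.sub (stronglyMeasurable_condExp.mono (ℱ.le k)).measurable).abs)
  have hle : ∀ k n, k ≤ n → ∀ᵐ ω ∂q, q[fun ω => |R ω - q[R|ℱ n] ω| | ℱ n] ω ≤
      q[fun ω => |R ω - q[R|ℱ k] ω| | ℱ n] ω + |q[R|ℱ k] ω - q[R|ℱ n] ω| := by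
    intro k n hkn
    have hi : Integrable (fun ω => |q[R|ℱ k] ω - q[R|ℱ n] ω|) q :=
      (integrable_condExp.sub integrable_condExp).abs
    have hsm : StronglyMeasurable[ℱ n] (fun ω => |q[R|ℱ k] ω - q[R|ℱ n] ω|) :=
      StronglyMeasurable.norm (f := fun ω => q[R|ℱ k] ω - q[R|ℱ n] ω)
        ((stronglyMeasurable_condExp.mono (ℱ.mono hkn)).sub stronglyMeasurable_condExp)
    have h1 := condExp_mono (m := ℱ n) (hint n) ((hint k).add hi)
      (Eventually.of_forall fun ω => abs_sub_le (R ω) (q[R|ℱ k] ω) (q[R|ℱ n] ω))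
    have h2 := condExp_add (hint k) hi (ℱ n)
    rw [condExp_of_stronglyMeasurable (ℱ.le n) hsm hi] at h2
    filter_upwards [h1, h2] with ω h1 h2
    exact h1.trans_eq h2
  have hnn : ∀ n, ∀ᵐ ω ∂q, 0 ≤ q[fun ω => |R ω - q[R|ℱ n] ω| | ℱ n] ω := fun n =>
    condExp_nonneg (Eventually.of_forall fun ω => abs_nonneg _)
  filter_upwards [hRl, ae_all_iff.2 hRk, ae_all_iff.2 fun k => ae_all_iff.2 fun n =>
    ae_all_iff.2 (hle k n), ae_all_iff.2 hnn] with ω h1 h2 h3 h4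
  have h5 : ∀ k, Tendsto (fun n => q[fun ω => |R ω - q[R|ℱ k] ω| | ℱ n] ω
      + |q[R|ℱ k] ω - q[R|ℱ n] ω|) atTop
      (𝓝 (|R ω - q[R|ℱ k] ω| + |q[R|ℱ k] ω - R ω|)) := fun k =>
    (h2 k).add (tendsto_const_nhds.sub h1).abs
  have h6 : Tendsto (fun k => |R ω - q[R|ℱ k] ω| + |q[R|ℱ k] ω - R ω|) atTop (𝓝 0) := by
    have := (tendsto_const_nhds (x := R ω).sub h1).abs.add (h1.sub (tendsto_const_nhds (x := R ω))).abs
    simpa using this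
  refine tendsto_order.2 ⟨fun a ha => Eventually.of_forall fun n => ha.trans_le (h4 n),
    fun a ha => ?_⟩
  obtain ⟨k, hk⟩ := (h6.eventually_lt_const ha).exists
  filter_upwards [(h5 k).eventually_lt_const hk, eventually_ge_atTop k] with n hn hkn
  exact (h3 k n hkn).trans_lt hn

/-- A form of the Blackwell–Dubins merging theorem: if `p ≪ q`, the conditional expectations under
`p` and `q` given `ℱₙ` get close `p`-almost surely, at a rate `D` that is the same for all functions
bounded by `1`, even if the function changes with `n`. -/
theorem exists_tendsto_zero_abs_condExp_sub_condExp_le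
    [IsProbabilityMeasure p] [IsProbabilityMeasure q]
    (hpq : p ≪ q) (ℱ : Filtration ℕ m0) (hℱ : ⨆ n, ℱ n = m0) :
    ∃ D : ℕ → Ω → ℝ, (∀ᵐ ω ∂p, Tendsto (fun n => D n ω) atTop (𝓝 0)) ∧
      ∀ n, ∀ f : Ω → ℝ, Measurable f → (∀ ω, |f ω| ≤ 1) →
        ∀ᵐ ω ∂p, |p[f|ℱ n] ω - q[f|ℱ n] ω| ≤ D n ω := by
  set R : Ω → ℝ := fun ω => (p.rnDeriv q ω).toReal with hRdef
  have hRm : Measurable R := (Measure.measurable_rnDeriv p q).ennreal_toReal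
  have hR : Integrable R q := Measure.integrable_toReal_rnDeriv
  have hRpos : ∀ᵐ ω ∂p, 0 < R ω := ae_toReal_rnDeriv_pos hpq
  -- the conditional mean deviation of `R` relative to the density of `p` on `ℱ n`
  refine ⟨fun n ω => q[fun ω => |R ω - q[R|ℱ n] ω| | ℱ n] ω / q[R|ℱ n] ω, ?_, ?_⟩
  · filter_upwards [hRpos, hpq.ae_le (tendsto_condExp_abs_sub_condExp ℱ hℱ hR hRm),
      hpq.ae_le (hR.tendsto_ae_condExp (ℱ := ℱ) (by rw [hℱ]; exact hRm.stronglyMeasurable))]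
      with ω h0 h1 h2
    exact (zero_div (R ω)) ▸ Tendsto.div h1 h2 h0.ne'
  · intro n f hf hf1
    have hfp : Integrable f p := .of_bound hf.aestronglyMeasurable 1 (Eventually.of_forall hf1)
    have hfq : Integrable f q := .of_bound hf.aestronglyMeasurable 1 (Eventually.of_forall hf1)
    -- `q[R|ℱ n]` is the density of `p` with respect to `q` on `ℱ n`, hence positive `p`-a.e.
    have hpos : ∀ᵐ ω ∂p, 0 < q[R|ℱ n] ω := by
      filter_upwards [ae_of_ae_trim (ℱ.le n) (ae_toReal_rnDeriv_pos (hpq.trim (ℱ.le n))),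
        hpq.ae_le (ae_eq_of_ae_eq_trim (toReal_rnDeriv_trim (ℱ.le n) hpq))] with ω h1 h2
      exact h1.trans_eq h2
    have hRf : Integrable (fun ω => R ω * f ω) q := (integrable_rnDeriv_smul_iff hpq).2 hfp
    have hcf : Integrable (fun ω => q[R|ℱ n] ω * f ω) q :=
      integrable_condExp.mul_bdd (c := 1) hf.aestronglyMeasurable (Eventually.of_forall hf1)
    have hB := condExp_mul_condExp_rnDeriv hpq (ℱ.le n) hfp
    have hpull : q[fun ω => q[R|ℱ n] ω * f ω|ℱ n] =ᵐ[q] fun ω => q[R|ℱ n] ω * q[f|ℱ n] ω :=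
      condExp_mul_of_stronglyMeasurable_left stronglyMeasurable_condExp hcf hfq
    have hsub := condExp_sub hRf hcf (ℱ n)
    have hnorm := norm_condExp_le (μ := q) (m := ℱ n)
      ((fun ω => R ω * f ω) - fun ω => q[R|ℱ n] ω * f ω)
    have hmono : q[fun ω => ‖((fun ω => R ω * f ω) - fun ω => q[R|ℱ n] ω * f ω) ω‖|ℱ n] ≤ᵐ[q]
        q[fun ω => |R ω - q[R|ℱ n] ω| | ℱ n] := by
      refine condExp_mono (hRf.sub hcf).norm (hR.sub integrable_condExp).abs
        (Eventually.of_forall fun ω => ?_)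
      simp only [Pi.sub_apply, ← sub_mul, norm_mul, Real.norm_eq_abs]
      exact mul_le_of_le_one_right (abs_nonneg _) (hf1 ω)
    filter_upwards [hpos, hpq.ae_le hB, hpq.ae_le hpull, hpq.ae_le hsub, hpq.ae_le hnorm,
      hpq.ae_le hmono] with ω h0 h1 h2 h3 h4 h5
    rw [le_div_iff₀ h0]
    calc |p[f|ℱ n] ω - q[f|ℱ n] ω| * q[R|ℱ n] ω
        = ‖q[(fun ω => R ω * f ω) - fun ω => q[R|ℱ n] ω * f ω|ℱ n] ω‖ := by
          rw [h3, Pi.sub_apply, h2, ← h1, Real.norm_eq_abs, mul_comm (q[R|ℱ n] ω), ← sub_mul,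
            abs_mul, abs_of_pos h0]
      _ ≤ _ := h4.trans h5

end Merging

/-! ### Comparing two laws through a generating algebra of sets -/

section TotalVariation

open scoped symmDiff

variable {Y : Type*} [mY : MeasurableSpace Y] {κ η : Measure Y}

/-- A bound on the difference of two probability measures over a generating algebra extends to all
measurable sets, since the algebra is dense for the measure `κ + η`. -/
lemma abs_measureReal_sub_le_of_isSetAlgebra [IsProbabilityMeasure κ] [IsProbabilityMeasure η]
    {𝒜 : Set (Set Y)} (h𝒜 : IsSetAlgebra 𝒜) (hgen : mY = MeasurableSpace.generateFrom 𝒜)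
    {c : ℝ} (hc : ∀ s ∈ 𝒜, |κ.real s - η.real s| ≤ c) {s : Set Y} (hs : MeasurableSet s) :
    |κ.real s - η.real s| ≤ c := by
  have hdense : (κ + η).MeasureDense 𝒜 :=
    Measure.MeasureDense.of_generateFrom_isSetAlgebra_finite (κ + η) h𝒜 hgen
  refine le_of_forall_pos_le_add fun ε hε => ?_
  obtain ⟨t, ht, hst⟩ := hdense.approx s hs (measure_ne_top _ _) ε hε
  have hlt : κ.real (s ∆ t) + η.real (s ∆ t) < ε := by
    rw [← measureReal_add_apply]
    exact (ENNReal.lt_ofReal_iff_toReal_lt (measure_ne_top _ _)).1 hst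
  have htm := hdense.measurable t ht
  have h1 := abs_measureReal_sub_le_measureReal_symmDiff (μ := κ) hs.nullMeasurableSet
    htm.nullMeasurableSet
  have h2 := abs_measureReal_sub_le_measureReal_symmDiff (μ := η) hs.nullMeasurableSet
    htm.nullMeasurableSet
  have h3 := hc t ht
  rw [abs_le] at *
  constructor <;> linarith [h1.1, h1.2, h2.1, h2.2, h3.1, h3.2]

/-- Uniform closeness on measurable sets controls integrals of bounded functions, by the layer cake
formula for the nonnegative function `g + C`. -/
lemma abs_integral_sub_le_of_abs_measureReal_sub_le
    [IsProbabilityMeasure κ] [IsProbabilityMeasure η] {c C : ℝ}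
    (hc : ∀ s, MeasurableSet s → |κ.real s - η.real s| ≤ c) {g : Y → ℝ} (hg : Measurable g)
    (hgC : ∀ y, |g y| ≤ C) : |∫ y, g y ∂κ - ∫ y, g y ∂η| ≤ 2 * C * c := by
  obtain ⟨y0⟩ : Nonempty Y := nonempty_of_isProbabilityMeasure κ
  have hC : 0 ≤ C := (abs_nonneg _).trans (hgC y0)
  have hlayer : ∀ (ρ : Measure Y) [IsProbabilityMeasure ρ],
      ∫ y, g y ∂ρ = (∫ t in (0 : ℝ)..2 * C, ρ.real {y | t < g y + C}) - C ∧
        IntervalIntegrable (fun t => ρ.real {y | t < g y + C}) volume 0 (2 * C) := by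
    intro ρ _
    have hgi : Integrable g ρ := .of_bound hg.aestronglyMeasurable C (Eventually.of_forall hgC)
    have hanti : Antitone fun t : ℝ => ρ.real {y | t < g y + C} := fun a b hab =>
      measureReal_mono fun y (hy : b < g y + C) => hab.trans_lt hy
    refine ⟨?_, hanti.intervalIntegrable⟩
    have h := (hgi.add (integrable_const C)).integral_eq_integral_meas_lt
      (Eventually.of_forall fun y => by
        simpa using neg_le_iff_add_nonneg.1 (abs_le.1 (hgC y)).1)
    simp only [Pi.add_apply] at h
    rw [integral_add hgi (integrable_const C)] at h
    simp only [integral_const, probReal_univ, one_smul] at h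
    rw [intervalIntegral.integral_of_le (by positivity), eq_sub_iff_add_eq, h]
    refine setIntegral_eq_of_subset_of_forall_sdiff_eq_zero measurableSet_Ioi
      (fun t ht => ht.1) fun t ht => ?_
    have ht' : 2 * C < t := by
      by_contra hcon
      exact ht.2 ⟨ht.1, not_lt.1 hcon⟩
    have : {y | t < g y + C} = ∅ := by
      ext y
      have := (abs_le.1 (hgC y)).2
      simp only [Set.mem_ofPred_eq, Set.mem_empty_iff_false, iff_false, not_lt]
      linarith
    rw [this, measureReal_empty]
  rw [(hlayer κ).1, (hlayer η).1, sub_sub_sub_cancel_right,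
    ← intervalIntegral.integral_sub (hlayer κ).2 (hlayer η).2]
  have := intervalIntegral.norm_integral_le_of_norm_le_const (a := 0) (b := 2 * C) (C := c)
    (f := fun t => κ.real {y | t < g y + C} - η.real {y | t < g y + C})
    fun t _ => hc _ (measurableSet_lt measurable_const (hg.add_const C))
  rw [sub_zero, abs_of_nonneg (by positivity)] at this
  exact this.trans_eq (mul_comm _ _)

end TotalVariation

namespace ControlledFilter

/-! ### The filtration of the measurements and the law of the next measurement -/

section Measurements

variable {X Y U : Type*} [MeasurableSpace X] [MeasurableSpace Y] [MeasurableSpace U]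

lemma measurable_past (n : ℕ) : Measurable (past (Y := Y) n) :=
  measurable_pi_lambda _ fun i => measurable_pi_apply (i : ℕ)

/-- The filtration generated by the measurements: at time `n` the measurements
`y₀, …, yₙ₋₁` are known. -/
def pastFiltration (Y : Type*) [MeasurableSpace Y] :
    Filtration ℕ (MeasurableSpace.pi : MeasurableSpace (ℕ → Y)) where
  seq n := MeasurableSpace.comap (past n) inferInstance
  mono' k n hkn := by
    rw [← measurable_iff_comap_le]
    exact (measurable_pi_lambda (fun (h : Fin n → Y) (i : Fin k) => h (Fin.castLE hkn i))
      fun i => measurable_pi_apply _).comp (comap_measurable (past n))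
  le' n := (measurable_past n).comap_le

lemma iSup_pastFiltration : ⨆ n, pastFiltration Y n = MeasurableSpace.pi := by
  refine le_antisymm (iSup_le fun n => (pastFiltration Y).le n) (iSup_le fun i => ?_)
  refine le_trans ?_ (le_iSup (fun n => pastFiltration Y n) (i + 1))
  rw [← measurable_iff_comap_le]
  exact (measurable_pi_apply (Fin.last i)).comp (comap_measurable (past (i + 1)))

/-- The sequence of measurements of a trajectory. -/
def measurements (ω : ℕ → X × Y) : ℕ → Y := fun n => (ω n).2

lemma measurable_measurements : Measurable (measurements (X := X) (Y := Y)) :=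
  measurable_pi_lambda _ fun n => measurable_snd.comp (measurable_pi_apply n)

variable (T : Kernel (X × U) X) [IsMarkovKernel T] (Q : Kernel X Y) [IsMarkovKernel Q]
    (γ : Policy Y U)

/-- Absolute continuity of the initial laws passes to the whole trajectories, because the same
transition kernels drive both. -/
lemma strategicMeasure_absolutelyContinuous {μ ν : Measure X} [SFinite ν] (h : μ ≪ ν) :
    strategicMeasure T Q γ μ ≪ strategicMeasure T Q γ ν :=
  Measure.AbsolutelyContinuous.comp_right
    ((h.compProd_left Q).map (MeasurableEquiv.measurable _)) _

lemma map_eval_zero_strategicMeasure (μ : Measure X) :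
    (strategicMeasure T Q γ μ).map (fun ω => ω 0) = μ ⊗ₘ Q := by
  have h0 : (fun ω : ℕ → X × Y => ω 0) =
      (fun h : (i : Finset.Iic 0) → X × Y => h ⟨0, by simp⟩) ∘ Preorder.frestrictLe 0 := rfl
  rw [h0, ← Measure.map_map (measurable_pi_apply _) (by fun_prop), strategicMeasure,
    Kernel.trajMeasure, Measure.map_comp _ _ (by fun_prop), Kernel.traj_map_frestrictLe,
    Kernel.partialTraj_self, Measure.id_comp,
    Measure.map_map (measurable_pi_apply _) (MeasurableEquiv.measurable _)]
  exact Measure.map_id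

/-- Under `m ⊗ (K ⊗ Q)`, the last coordinate has conditional law `Q x` given the others. -/
lemma compProd_prod_preimage_snd {H : Type*} [MeasurableSpace H] (m : Measure H) [SFinite m]
    (K : Kernel H X) [IsMarkovKernel K] {B : Set H} (hB : MeasurableSet B) {A : Set Y}
    (hA : MeasurableSet A) :
    (m ⊗ₘ (K ⊗ₖ Kernel.prodMkLeft H Q)) (B ×ˢ (Prod.snd ⁻¹' A)) =
      ∫⁻ z in B ×ˢ Set.univ, Q z.2.1 A ∂(m ⊗ₘ (K ⊗ₖ Kernel.prodMkLeft H Q)) := by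
  have hQA : Measurable fun x => Q x A := Q.measurable_coe hA
  rw [Measure.compProd_apply_prod hB (measurable_snd hA),
    Measure.setLIntegral_compProd (f := fun z : H × X × Y => Q z.2.1 A)
      (hQA.comp (measurable_fst.comp measurable_snd)) hB .univ]
  refine setLIntegral_congr_fun hB fun h _ => ?_
  rw [← Set.univ_prod, Kernel.compProd_apply_prod .univ hA]
  simp only [Measure.restrict_univ, Kernel.prodMkLeft_apply]
  rw [Kernel.lintegral_compProd _ _ _ (f := fun z : X × Y => Q z.1 A) (hQA.comp measurable_fst)]
  simp

variable (μ ν : Measure X) [IsProbabilityMeasure μ] [IsProbabilityMeasure ν]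

/-- Given the past measurements and the current state, the current measurement has law
`Q(dy | xₙ)`: the defining property of the sensor, integrated over events of the measurement
past. -/
lemma strategicMeasure_past_mem_inter (n : ℕ) {B : Set (Fin n → Y)} (hB : MeasurableSet B)
    {A : Set Y} (hA : MeasurableSet A) :
    strategicMeasure T Q γ μ
        ((fun ω => past n (measurements ω)) ⁻¹' B ∩ (fun ω => (ω n).2) ⁻¹' A) =
      ∫⁻ ω in (fun ω => past n (measurements ω)) ⁻¹' B, Q (ω n).1 A
        ∂(strategicMeasure T Q γ μ) := by
  have hQA : Measurable fun x => Q x A := Q.measurable_coe hA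
  cases n with
  | zero =>
    -- there is no past: `B` is empty or everything
    rcases Set.eq_empty_or_nonempty B with rfl | ⟨b, hb⟩
    · simp
    obtain rfl : B = Set.univ := Set.eq_univ_of_forall fun y => Subsingleton.elim b y ▸ hb
    have h0 : Measurable fun ω : ℕ → X × Y => ω 0 := measurable_pi_apply 0
    rw [Set.preimage_univ, Set.univ_inter, Measure.restrict_univ,
      ← lintegral_map (f := fun z : X × Y => Q z.1 A) (hQA.comp measurable_fst) h0,
      show (fun ω : ℕ → X × Y => (ω 0).2) ⁻¹' A = (fun ω => ω 0) ⁻¹' (Prod.snd ⁻¹' A) from rfl,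
      ← Measure.map_apply h0 (measurable_snd hA), map_eval_zero_strategicMeasure,
      Measure.lintegral_compProd (f := fun z : X × Y => Q z.1 A) (hQA.comp measurable_fst),
      ← Set.univ_prod,
      Measure.compProd_apply_prod .univ hA]
    simp
  | succ n =>
    have hrest : Measurable fun ω : ℕ → X × Y => (Preorder.frestrictLe n ω, ω (n + 1)) := by
      fun_prop
    -- the measurements `y₀, …, yₙ` as a function of the history up to time `n`
    let r : ((i : Finset.Iic n) → X × Y) → Fin (n + 1) → Y := fun h i =>
      (h ⟨i, Finset.mem_Iic.2 (Nat.le_of_lt_succ i.2)⟩).2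
    have hr : Measurable r := measurable_pi_lambda _ fun i =>
      measurable_snd.comp (measurable_pi_apply _)
    have hlaw := Kernel.map_frestrictLe_trajMeasure_compProd_eq_map_trajMeasure
      (X := fun _ => X × Y) (μ₀ := μ ⊗ₘ Q) (κ := fun n => stepKernel T Q γ n) (a := n)
    have h := compProd_prod_preimage_snd Q ((strategicMeasure T Q γ μ).map (Preorder.frestrictLe n))
      (T.comap (stateAction γ n) (measurable_stateAction γ n)) (hr hB) hA
    change ((strategicMeasure T Q γ μ).map (Preorder.frestrictLe n) ⊗ₘ stepKernel T Q γ n) _ =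
      ∫⁻ z in _, _ ∂((strategicMeasure T Q γ μ).map (Preorder.frestrictLe n) ⊗ₘ
        stepKernel T Q γ n) at h
    change (strategicMeasure T Q γ μ).map (Preorder.frestrictLe n) ⊗ₘ stepKernel T Q γ n =
      (strategicMeasure T Q γ μ).map _ at hlaw
    rw [hlaw, Measure.map_apply hrest ((hr hB).prod (measurable_snd hA)),
      setLIntegral_map ((hr hB).prod .univ)
        (f := fun z : ((i : Finset.Iic n) → X × Y) × X × Y => Q z.2.1 A)
        (hQA.comp (measurable_fst.comp measurable_snd)) hrest]
      at h
    rw [Set.mk_preimage_prod, Set.mk_preimage_prod, Set.preimage_univ, Set.inter_univ] at h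
    exact h

variable [StandardBorelSpace X] [Nonempty X]

instance (n : ℕ) : IsMarkovKernel (predictor T Q γ μ n) := by
  unfold predictor; infer_instance

/-- Given the past measurements, the next measurement has conditional law `Q ∘ π_{n-}`. -/
lemma map_past_compProd_predictor (n : ℕ) :
    ((strategicMeasure T Q γ μ).map measurements).map (fun y => (past n y, y n)) =
      ((strategicMeasure T Q γ μ).map measurements).map (past n) ⊗ₘ
        (Q ∘ₖ predictor T Q γ μ n) := by
  have hm := measurable_measurements (X := X) (Y := Y)
  have hp : Measurable fun ω : ℕ → X × Y => past n (measurements ω) := (measurable_past n).comp hm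
  have hx : Measurable fun ω : ℕ → X × Y => (ω n).1 := measurable_fst.comp (measurable_pi_apply n)
  have hpair : Measurable fun y : ℕ → Y => (past n y, y n) :=
    (measurable_past n).prodMk (measurable_pi_apply n)
  refine Measure.ext_prod fun {B A} hB hA => ?_
  have hQA : Measurable fun x => Q x A := Q.measurable_coe hA
  rw [Measure.map_map hpair hm, Measure.map_map (measurable_past n) hm,
    Measure.map_apply (hpair.comp hm) (hB.prod hA)]
  refine (strategicMeasure_past_mem_inter T Q γ μ n hB hA).trans ?_
  have hcond : (strategicMeasure T Q γ μ).map (fun ω => past n (measurements ω)) ⊗ₘ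
      predictor T Q γ μ n = (strategicMeasure T Q γ μ).map
        fun ω => (past n (measurements ω), (ω n).1) :=
    compProd_map_condDistrib hx.aemeasurable
  have h1 := setLIntegral_map (μ := strategicMeasure T Q γ μ) (hB.prod .univ)
    (hQA.comp measurable_snd) (hp.prodMk hx)
  rw [← hcond, Measure.setLIntegral_compProd (hQA.comp measurable_snd) hB .univ,
    Set.mk_preimage_prod, Set.preimage_univ, Set.inter_univ] at h1
  refine h1.symm.trans ?_
  rw [Measure.compProd_apply_prod hB hA]
  refine setLIntegral_congr_fun hB fun h _ => ?_
  rw [Kernel.comp_apply' _ _ _ hA, Measure.restrict_univ]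
  rfl

lemma condExp_indicator_measurement_ae_eq [StandardBorelSpace Y] (n : ℕ) {A : Set Y}
    (hA : MeasurableSet A) :
    ((strategicMeasure T Q γ μ).map measurements)[
        ((fun y : ℕ → Y => y n) ⁻¹' A).indicator fun _ => (1 : ℝ) | pastFiltration Y n]
      =ᵐ[(strategicMeasure T Q γ μ).map measurements]
        fun y => ((Q ∘ₖ predictor T Q γ μ n) (past n y)).real A := by
  have : IsProbabilityMeasure ((strategicMeasure T Q γ μ).map measurements) :=
    Measure.isProbabilityMeasure_map measurable_measurements.aemeasurable
  obtain ⟨x⟩ := ‹Nonempty X›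
  have : Nonempty Y := nonempty_of_isProbabilityMeasure (Q x)
  have h1 := condDistrib_ae_eq_of_measure_eq_compProd (past n)
    (measurable_pi_apply n).aemeasurable (map_past_compProd_predictor T Q γ μ n)
  have h2 := condDistrib_ae_eq_condExp (μ := (strategicMeasure T Q γ μ).map measurements)
    (measurable_past (Y := Y) n) (measurable_pi_apply n) hA
  filter_upwards [ae_of_ae_map (measurable_past n).aemeasurable h1, h2] with y h1 h2
  rw [← h1, h2]
  rfl

variable {μ ν} in
/-- Almost surely under the law started from `μ`, the one-step predictions of the measurement made
from `μ` and from `ν` merge in total variation. Merging on a countable generating algebra suffices,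
because the rate is uniform over sets; this is what keeps the exceptional null set independent of
any test function. -/
theorem ae_exists_tendsto_zero_abs_measurement_law_sub_le [StandardBorelSpace Y] (h : μ ≪ ν) :
    ∀ᵐ y ∂((strategicMeasure T Q γ μ).map measurements), ∃ d : ℕ → ℝ, Tendsto d atTop (𝓝 0) ∧
      ∀ n, ∀ A : Set Y, MeasurableSet A →
        |((Q ∘ₖ predictor T Q γ μ n) (past n y)).real A -
          ((Q ∘ₖ predictor T Q γ ν n) (past n y)).real A| ≤ d n := by
  have hp : ∀ (ρ : Measure X) [IsProbabilityMeasure ρ],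
      IsProbabilityMeasure ((strategicMeasure T Q γ ρ).map measurements) := fun ρ _ =>
    Measure.isProbabilityMeasure_map measurable_measurements.aemeasurable
  have hpμ := hp μ
  have hpν := hp ν
  have hpq := (strategicMeasure_absolutelyContinuous T Q γ h).map
    (measurable_measurements (X := X) (Y := Y))
  obtain ⟨D, hD, hle⟩ := exists_tendsto_zero_abs_condExp_sub_condExp_le hpq
    (pastFiltration Y) iSup_pastFiltration
  let 𝒜 : Set (Set Y) := generateSetAlgebra (MeasurableSpace.countableGeneratingSet Y)
  have hgen : ‹MeasurableSpace Y› = MeasurableSpace.generateFrom 𝒜 := by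
    rw [generateFrom_generateSetAlgebra_eq, MeasurableSpace.generateFrom_countableGeneratingSet]
  have hcount : 𝒜.Countable :=
    countable_generateSetAlgebra MeasurableSpace.countable_countableGeneratingSet
  have hall : ∀ n, ∀ A ∈ 𝒜, ∀ᵐ y ∂((strategicMeasure T Q γ μ).map measurements),
      |((Q ∘ₖ predictor T Q γ μ n) (past n y)).real A -
          ((Q ∘ₖ predictor T Q γ ν n) (past n y)).real A| ≤ D n y := by
    intro n A hA
    have hAm : MeasurableSet A := by
      rw [hgen]; exact MeasurableSpace.measurableSet_generateFrom hA
    have hm : MeasurableSet ((fun y : ℕ → Y => y n) ⁻¹' A) := measurable_pi_apply n hAm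
    filter_upwards [hle n _ ((measurable_const (a := (1 : ℝ))).indicator hm) fun y => by
        by_cases hy : y ∈ (fun y : ℕ → Y => y n) ⁻¹' A <;> simp [Set.indicator, hy],
      condExp_indicator_measurement_ae_eq T Q γ μ n hAm,
      hpq.ae_le (condExp_indicator_measurement_ae_eq T Q γ ν n hAm)] with y h1 h2 h3
    rwa [← h2, ← h3]
  filter_upwards [hD, ae_all_iff.2 fun n => (ae_ball_iff hcount).2 (hall n)] with y h1 h2
  exact ⟨fun n => D n y, h1, fun n A hA =>
    abs_measureReal_sub_le_of_isSetAlgebra isSetAlgebra_generateSetAlgebra hgen (h2 n) hA⟩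

end Measurements

/-! ### From measurement laws to state laws -/

/-- Observability turns total variation merging of the measurement laws into weak merging of the
state laws: a test function is uniformly close to `x ↦ ∫ g dQ(x)`, whose integral against a state
law is the integral of `g` against the measurement law. -/
lemma mergeWeakly_of_oneStepObservable {X Y : Type*} [MeasurableSpace X] [MeasurableSpace Y]
    (Q : Kernel X Y) [IsMarkovKernel Q] [TopologicalSpace X] [OpensMeasurableSpace X]
    (hQ : OneStepObservable Q) {P P' : ℕ → Measure X} [∀ n, IsProbabilityMeasure (P n)]
    [∀ n, IsProbabilityMeasure (P' n)] {d : ℕ → ℝ} (hd : Tendsto d atTop (𝓝 0))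
    (h : ∀ n, ∀ A : Set Y, MeasurableSet A → |(Q ∘ₘ P n).real A - (Q ∘ₘ P' n).real A| ≤ d n) :
    MergeWeakly P P' := by
  intro f
  refine tendsto_order.2 ⟨fun a ha => Eventually.of_forall fun n => ha.trans_le (abs_nonneg _),
    fun a ha => ?_⟩
  -- two approximation errors and the merging error, each at most `a / 4`, add up to less than `a`
  obtain ⟨g, hg, ⟨C, hC⟩, hfg⟩ := hQ f (a / 4) (by positivity)
  have hlim : Tendsto (fun n => 2 * C * d n) atTop (𝓝 0) := by simpa using hd.const_mul (2 * C)
  have happrox : ∀ (ρ : Measure X) [IsProbabilityMeasure ρ],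
      |∫ x, f x ∂ρ - ∫ y, g y ∂(Q ∘ₘ ρ)| ≤ a / 4 := by
    intro ρ _
    have hgi : Integrable g (Q ∘ₘ ρ) := .of_bound hg.aestronglyMeasurable C (Eventually.of_forall hC)
    have hgQ : Integrable (fun x => ∫ y, g y ∂(Q x)) ρ := Integrable.of_bound
      hg.stronglyMeasurable.integral_kernel.aestronglyMeasurable C (Eventually.of_forall fun x => by
        simpa using norm_integral_le_of_norm_le_const (μ := Q x) (f := g) (C := C)
          (Eventually.of_forall hC))
    have hint : ∫ y, g y ∂(Q ∘ₘ ρ) = ∫ x, ∫ y, g y ∂(Q x) ∂ρ := by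
      rw [Measure.comp_eq_comp_const_apply] at hgi ⊢
      rw [Kernel.integral_comp hgi, Kernel.const_apply]
    rw [hint, ← integral_sub (f.integrable ρ) hgQ]
    simpa using norm_integral_le_of_norm_le_const (μ := ρ) (C := a / 4)
      (f := fun x => f x - ∫ y, g y ∂(Q x))
      (Eventually.of_forall fun x => (hfg x).le)
  filter_upwards [hlim.eventually_lt_const (show 0 < a / 4 by positivity)] with n hn
  have h1 := happrox (P n)
  have h2 := happrox (P' n)
  have h3 := abs_integral_sub_le_of_abs_measureReal_sub_le (h n) hg hC
  rw [abs_le] at h1 h2 h3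
  rw [abs_lt]
  constructor <;> linarith

end ControlledFilter

/-! ### Merging of the predictors -/

theorem mainTheorem1 {X Y U : Type*}
    [TopologicalSpace X] [PolishSpace X] [SigmaCompactSpace X] [Nonempty X]
    [MeasurableSpace X] [BorelSpace X]
    [TopologicalSpace Y] [PolishSpace Y] [MeasurableSpace Y] [BorelSpace Y]
    [TopologicalSpace U] [PolishSpace U] [MeasurableSpace U] [BorelSpace U]
    (T : Kernel (X × U) X) [IsMarkovKernel T] (Q : Kernel X Y) [IsMarkovKernel Q]
    (μ ν : Measure X) [IsProbabilityMeasure μ] [IsProbabilityMeasure ν]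
    (hμν : μ ≪ ν) (hQ : ControlledFilter.OneStepObservable Q) :
    ∀ γ : ControlledFilter.Policy Y U,
      ControlledFilter.PredictorsMergeWeaklyAS T Q γ μ ν := by
  intro γ
  have hmeas := ControlledFilter.measurable_measurements (X := X) (Y := Y)
  have : IsProbabilityMeasure ((ControlledFilter.strategicMeasure T Q γ μ).map
      ControlledFilter.measurements) := Measure.isProbabilityMeasure_map hmeas.aemeasurable
  have hae := ControlledFilter.ae_exists_tendsto_zero_abs_measurement_law_sub_le T Q γ hμν
  obtain ⟨A, hA, hAm, hlaw⟩ := hae.exists_measurable_mem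
  refine ⟨A, hAm, ?_, fun y hy => ?_⟩
  · have h := (prob_compl_eq_zero_iff hAm).1 (mem_ae_iff.1 hA)
    rwa [Measure.map_apply hmeas hAm] at h
  · obtain ⟨d, hd, hdA⟩ := hlaw y hy
    refine ControlledFilter.mergeWeakly_of_oneStepObservable Q hQ hd fun n B hB => ?_
    simpa only [Kernel.comp_apply] using hdA n B hB
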